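/- A circle in the plane has positive radius, and its interior is the open disc it bounds. For points $a,b\in\mathbb R^2$ let $[a,b]$ be the closed segment and $(a,b)=[a,b]\setminus\{a,b\}$. A betweenness isomorphism of $S,R\subset\mathbb R^2$ is a bijection $f\colon S\to R$ such that $c\in(a,b)\iff f(c)\in(f(a),f(b))$ for all $a,b,c\in S$; $S$ and $R$ are betweenness isomorphic if one exists. Let $\mathcal F$ be the family of all sets $C\cup\{c_1,c_2,c_3\}\subset\mathbb R^2$, where $C$ is a circle and $c_1,c_2,c_3$ are pairwise distinct collinear points in the interior of $C$. Betweenness isomorphism classes below are those of members of $\mathcal F$ within $\mathcal F$. Let $\mathcal K_3$ be the collection of all pairs $s=(C,(c_1,c_2,c_3))$, where $C$ is a circle and $c_1,c_2,c_3$ are pairwise distinct collinear points in its interior with $c_2\in(c_1,c_3)$, and put $\mathrm{set}(s)=C\cup\{c_1,c_2,c_3\}$. For such $s$, let $R_i\colon C\to C$ be the reversion through $c_i$: $R_i(c)$ is the unique point of $C$ with $c_i\in(c,R_i(c))$. For a finite (possibly empty) sequence $g=(i_1,\dots,i_n)$ in $\{1,2,3\}$ with $i_k\ne i_{k+1}$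 for $1\le k<n$, define its signature $N(g)=(N(g,1),N(g,2),N(g,3))\in\mathbb Z^3$ by $N(g,i)=\sum_{m:\,i_m=i}(-1)^{m+1}$. The collinear hull of $A\subset S$ in $S$ is the smallest set $B$ with $A\subset B\subset S$ such that $c\in B$ whenever $c\in S$ is collinear with two distinct points of $B\setminus\{c\}$. A vector $v\in\mathbb Z^3$ is a cycle for $s$ if there are a sequence $g$ as above with $N(g)=v$ and a point $c\in C$ outside the collinear hull of $\{c_1,c_2,c_3\}$ in $\mathrm{set}(s)$ such that $(R_{i_n}\circ\dots\circ R_{i_1})(c)=c$ (the empty composition being the identity). Put $$[[v]]=\{\mathrm{set}(s): s\in\mathcal K_3,\ v\text{ is a cycle for }s\},\qquad \mathbb O=\{\mathrm{set}(s): s\in\mathcal K_3,\ (0,0,0)\text{ is the only cycle for }s\}.$$ Theorem 4.5. The betweenness isomorphism classes of the sets in $\mathcal F$ are exactly the following, each listed once: - $[[v]]$, for $v=(v_1,v_2,v_3)\in\mathbb Z^3$ with $v_1+v_2+v_3=0$, $v_2\ge 1$, $v_1\le v_3\le -1$ and $\gcd(v_1,v_2,v_3)=1$; - $\mathbb O$.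 In particular, there are countably infinitely many classes. -/

import Mathlib

namespace CircleBetweenness

/-- The Euclidean plane. -/
abbrev Plane : Type := EuclideanSpace ℝ (Fin 2)

/-- Two planar sets are betweenness isomorphic if there is a bijection `f : S → R` such that, for
all `a b c ∈ S`, the point `c` lies in the open segment `[a,b] \ {a,b}` if and only if `f c` lies
in `[f a, f b] \ {f a, f b}`. (`Sbtw ℝ a c b` says `c ∈ [a,b]`, `c ≠ a` and `c ≠ b`.) -/
def BetweennessIsomorphic (S R : Set Plane) : Prop :=
  ∃ f : S ≃ R, ∀ a b c : S,
    Sbtw ℝ (a : Plane) (c : Plane) (b : Plane) ↔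
      Sbtw ℝ (f a : Plane) (f c : Plane) (f b : Plane)

/-- The betweenness isomorphism classes of a family `F` of planar sets. -/
def isoClasses (F : Set (Set Plane)) : Set (Set (Set Plane)) :=
  {K | ∃ S ∈ F, K = {R | R ∈ F ∧ BetweennessIsomorphic S R}}

/-- The sets `C ∪ {c₁, c₂, c₃}`, where `C` is a circle and `c₁, c₂, c₃` are pairwise distinct
collinear points in the interior of `C`. -/
def circlesWithThreeCollinearPoints : Set (Set Plane) :=
  {S | ∃ (C : EuclideanGeometry.Sphere Plane) (p : Fin 3 → Plane),
    0 < C.radius ∧ (∀ i, dist (p i) C.center < C.radius) ∧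
    Function.Injective p ∧ Collinear ℝ (Set.range p) ∧
    S = (C : Set Plane) ∪ Set.range p}

/-- `A` is collinearly closed in `S`: a point `c ∈ S` lies in `A` as soon as it is collinear with
two distinct points of `A \ {c}`. -/
def CollinearlyClosed (S A : Set Plane) : Prop :=
  ∀ c ∈ S, ∀ a ∈ A \ {c}, ∀ b ∈ A \ {c}, a ≠ b →
    Collinear ℝ ({a, b, c} : Set Plane) → c ∈ A

/-- The collinear hull of `A` in `S`: the smallest subset of `S` that contains `A` and is
collinearly closed in `S`. -/
def collinearHull (S A : Set Plane) : Set Plane :=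
  ⋂₀ {B | A ⊆ B ∧ B ⊆ S ∧ CollinearlyClosed S B}

/-- The reversion map of the circle `C` through `X`: it sends `c ∈ C` to the second point of
intersection of `C` with the line through `c` and `X`. -/
noncomputable def reversion (C : EuclideanGeometry.Sphere Plane) (X c : Plane) : Plane :=
  C.secondInter c (X -ᵥ c)

/-- For `X` in the interior of `C` and `c ∈ C`, the point `reversion C X c` is the unique point
`d` of `C` such that `X` lies in the open segment with end points `c` and `d`. -/
theorem eq_reversion_iff {C : EuclideanGeometry.Sphere Plane} {X c d : Plane}
    (hX : dist X C.center < C.radius) (hc : c ∈ C) :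
    d = reversion C X c ↔ d ∈ C ∧ Sbtw ℝ c X d := by
  constructor
  · rintro rfl
    exact ⟨(EuclideanGeometry.Sphere.secondInter_mem _).2 hc,
      EuclideanGeometry.Sphere.sbtw_secondInter hc hX⟩
  · rintro ⟨hd, hs⟩
    have hline : d ∈ line[ℝ, c, X] := hs.right_mem_affineSpan
    rcases (EuclideanGeometry.Sphere.eq_or_eq_secondInter_iff_mem_of_mem_affineSpan_pair
      hc hline).2 hd with h | h
    · exact absurd h.symm hs.left_ne_right
    · exact h

/-- A code: a circle together with points `pt 0, …, pt (l - 1)` in its interior which are pairwise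
distinct, collinear, and listed in one of the two natural orders of the line carrying them. -/
structure Code (l : ℕ) where
  circle : EuclideanGeometry.Sphere Plane
  radius_pos : 0 < circle.radius
  pt : Fin l → Plane
  interior : ∀ i, dist (pt i) circle.center < circle.radius
  ordered : ∃ (q d : Plane) (t : Fin l → ℝ), d ≠ 0 ∧ (StrictMono t ∨ StrictAnti t) ∧
    ∀ i, pt i = q + t i • d

/-- The planar set (the circle together with the interior points) described by a code. -/
def Code.toSet {l : ℕ} (s : Code l) : Set Plane :=
  (s.circle : Set Plane) ∪ Set.range s.pt

/-- The irreducible configurations: finite sequences of indices without two equal neighbours. -/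
def Irreducibles (l : ℕ) : Type := {g : List (Fin l) // g.IsChain (· ≠ ·)}

/-- The action on the circle: `c · (i₁, …, iₙ) = (R_{iₙ} ∘ ⋯ ∘ R_{i₁}) c`, where `R_i` is the
reversion through the `i`-th interior point; the empty configuration fixes every point. -/
noncomputable def Code.act {l : ℕ} (s : Code l) (c : Plane) (g : Irreducibles l) : Plane :=
  g.1.foldl (fun x i => reversion s.circle (s.pt i) x) c

/-- The signature of `g`: its `i`-th entry is the number of occurrences of `i` at the first, third,
fifth, … place minus the number of its occurrences at the second, fourth, … place. (The places are
numbered from `0` here.) -/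
def signature {l : ℕ} (g : Irreducibles l) : Fin l → ℤ :=
  fun i => ∑ m : Fin g.1.length, if g.1.get m = i then (-1 : ℤ) ^ (m : ℕ) else 0

/-- `v` is a cycle for `s`: some irreducible configuration with signature `v` stabilizes some point
of the circle outside the collinear hull of the interior points. -/
def IsCycle {l : ℕ} (s : Code l) (v : Fin l → ℤ) : Prop :=
  ∃ g : Irreducibles l, ∃ c ∈ (s.circle : Set Plane) \ collinearHull s.toSet (Set.range s.pt),
    signature g = v ∧ s.act c g = c

/-- The class `[[v]]` of all sets having a code for which `v` is a cycle. -/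
def cycleClass {l : ℕ} (v : Fin l → ℤ) : Set (Set Plane) :=
  {S | ∃ s : Code l, IsCycle s v ∧ s.toSet = S}

/-- The class `𝕆` of all sets having a code (with three interior points) whose only cycle is
`(0, 0, 0)`. -/
def zeroClass : Set (Set Plane) :=
  {S | ∃ s : Code 3, (∀ v : Fin 3 → ℤ, IsCycle s v ↔ v = 0) ∧ s.toSet = S}

/-- The balanced vectors `v = (v₁, v₂, v₃) ∈ ℤ³` with `v₂ ≥ 1`, `v₁ ≤ v₃ ≤ -1` and
`gcd v = 1`. -/
def normalizedVectors : Set (Fin 3 → ℤ) :=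
  {v | ∑ i, v i = 0 ∧ 1 ≤ v 1 ∧ v 0 ≤ v 2 ∧ v 2 ≤ -1 ∧ Finset.univ.gcd v = 1}

end CircleBetweenness

open CircleBetweenness

/-!
The line through the three interior points meets the circle in two points `A` and `B`. A point `X`
of the circle other than `A` and `B` is determined by the side of the line on which it lies and by
the number `x = log (XA / XB)`. By similar triangles, the second intersection `Y` of the circle
with the line `XP` through an interior point `P` of the chord `AB` lies on the opposite side and
satisfies `(XA / XB) * (YA / YB) = PA / PB`. In the coordinates `Bool × ℝ` the reversion through
`cᵢ` is therefore `(b, x) ↦ (!b, ℓᵢ - x)` with `ℓᵢ = log (cᵢA / cᵢB)` (`IsAdapted.exists_isParam`),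
and the whole betweenness structure of the set is encoded by the triple `ℓ₀ < ℓ₁ < ℓ₂`.

A configuration acts by a translation by `-∑ Nᵢ ℓᵢ` (even length) or exchanges the two sides (odd
length), so the cycles are exactly the integral vectors with `∑ vᵢ = 0` and `∑ vᵢ ℓᵢ = 0`
(`IsParam.isCycle_iff`), that is with `v₀ (ℓ₁ - ℓ₀) = v₂ (ℓ₂ - ℓ₁)`. Everything depends on whether
the ratio of the gaps `ℓ₁ - ℓ₀` and `ℓ₂ - ℓ₁` is rational.

An isomorphism maps the five points of the line to the five points of the line, preserving or
reversing their order, and intertwines the reversions, so it preserves the cycles up to the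
exchange of `v₀` and `v₂` (`IsRelation.of_equiv`). Conversely, an additive automorphism `E` of `ℝ`
that maps the gaps of one triple to the gaps of the other induces an isomorphism
`(b, x) ↦ (b, E x + c)` (`exists_model_equiv`): if the two triples share a nonzero relation, then
`E` is a homothety; if neither triple has one, then both pairs of gaps are linearly independent
over `ℚ` and `E` is a `ℚ`-linear automorphism of `ℝ`. The condition `v₀ ≤ v₂` selects one of the
two orders in which the interior points can be listed, and `gcd v = 1` selects one generator of the
group of cycles up to sign.
-/

namespace CircleBetweenness

/-! ### The combinatorial model -/

/-- Labels for the points of a circle with three collinear interior points. The labels `inl 0`,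
`inl 1`, `inl 2`, `inl 3`, `inl 4` stand for the five points on the carrying line, in their order
on the line, so that `inl 0` and `inl 4` are its points on the circle. The label `inr (b, x)`
stands for the remaining point of the circle that lies on the side `b` of the line and whose
distances from the two points `inl 0`, `inl 4` have the ratio `exp x`. -/
abbrev Label : Type := Fin 5 ⊕ (Bool × ℝ)

/-- The place, among the five points of the line, of the `j`-th interior point. -/
def node (j : Fin 3) : Fin 5 := j.succ.castSucc

/-- A reversion in the coordinates of `Label`. -/
def reflect (a : ℝ) (z : Bool × ℝ) : Bool × ℝ := (!z.1, a - z.2)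

/-- Betweenness in terms of labels: the second label is strictly between the first and the
third. The reversion through the `j`-th interior point has the parameter `ℓ j`. -/
def Between (ℓ : Fin 3 → ℝ) : Label → Label → Label → Prop
  | .inl i, .inl j, .inl k => (i < j ∧ j < k) ∨ (k < j ∧ j < i)
  | .inr z, .inl j, .inr w => ∃ i, j = node i ∧ w = reflect (ℓ i) z
  | _, _, _ => False

theorem reflect_reflect (a b : ℝ) (z : Bool × ℝ) :
    reflect a (reflect b z) = (z.1, z.2 + (a - b)) := by
  simp only [reflect, Bool.not_not, Prod.mk.injEq, true_and]
  ring

theorem node_injective : Function.Injective node := by decide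

theorem node_cases (i : Fin 5) : i = 0 ∨ i = 4 ∨ ∃ j, i = node j := by
  revert i; decide

/-- Only the three interior points lie strictly between two points. -/
theorem Between.exists_node {ℓ : Fin 3 → ℝ} {a c b : Label} (h : Between ℓ a c b) :
    ∃ j, c = .inl (node j) := by
  match a, c, b, h with
  | .inl i, .inl j, .inl k, h =>
    have : ∀ i j k : Fin 5, (i < j ∧ j < k) ∨ (k < j ∧ j < i) → ∃ l, j = node l := by decide
    obtain ⟨l, rfl⟩ := this i j k h
    exact ⟨l, rfl⟩
  | .inr z, .inl j, .inr w, ⟨i, hi, _⟩ => exact ⟨i, by rw [hi]⟩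

theorem between_node (ℓ : Fin 3 → ℝ) (j : Fin 3) :
    Between ℓ (.inl 0) (.inl (node j)) (.inl 4) := by
  simp only [Between]
  revert j; decide

theorem between_reflect (ℓ : Fin 3 → ℝ) (j : Fin 3) (z : Bool × ℝ) :
    Between ℓ (.inr z) (.inl (node j)) (.inr (reflect (ℓ j) z)) := ⟨j, rfl, rfl⟩

theorem between_inr_inr {ℓ : Fin 3 → ℝ} {j : Fin 3} {z w : Bool × ℝ} :
    Between ℓ (.inr z) (.inl (node j)) (.inr w) ↔ w = reflect (ℓ j) z := by
  constructor
  · rintro ⟨i, hi, h⟩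
    rwa [node_injective hi]
  · rintro rfl
    exact between_reflect ℓ j z

/-- An isomorphism of the models respects the five points of the line, preserving or reversing
their order, and hence intertwines the reversions. -/
theorem exists_intertwining {ℓ ℓ' : Fin 3 → ℝ} (f : Label ≃ Label)
    (hf : ∀ a c b, Between ℓ a c b ↔ Between ℓ' (f a) (f c) (f b)) :
    ∃ σ : Fin 3 → Fin 3, (σ = id ∨ σ = Fin.rev) ∧ ∃ g : Bool × ℝ → Bool × ℝ,
      ∀ i z, g (reflect (ℓ i) z) = reflect (ℓ' (σ i)) (g z) := by
  have h1 : ∀ i, ∃ j, f (.inl (node i)) = .inl (node j) := fun i =>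
    ((hf _ _ _).1 (between_node ℓ i)).exists_node
  choose σ hσ using h1
  have hσ' : σ = id ∨ σ = Fin.rev := by
    have h := (hf (.inl (node 0)) (.inl (node 1)) (.inl (node 2))).1 (by simp [Between, node])
    rw [hσ, hσ, hσ] at h
    have key : ∀ a b c : Fin 3, (node a < node b ∧ node b < node c) ∨
        (node c < node b ∧ node b < node a) → (a = 0 ∧ b = 1 ∧ c = 2) ∨
        (a = 2 ∧ b = 1 ∧ c = 0) := by decide
    rcases key _ _ _ h with ⟨h0, h1, h2⟩ | ⟨h0, h1, h2⟩
    · left; funext i; fin_cases i <;> simp [h0, h1, h2]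
    · right; funext i; fin_cases i <;> simp [h0, h1, h2, Fin.rev]
  have hsurj : ∀ j, ∃ i, σ i = j := by
    intro j
    rcases hσ' with h | h
    · exact ⟨j, by simp [h]⟩
    · exact ⟨j.rev, by simp [h]⟩
  have h2 : ∀ z, ∃ w, f (.inr z) = .inr w := by
    intro z
    rcases h : f (.inr z) with k | w
    · exfalso
      -- An end point of the line, unlike `inr z`, is collinear with two of the interior points.
      have key : ∀ i j, ¬ Between ℓ' (.inl k) (.inl (node i)) (.inl (node j)) := by
        intro i j hb
        obtain ⟨i, rfl⟩ := hsurj i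
        obtain ⟨j, rfl⟩ := hsurj j
        rw [← hσ, ← hσ, ← h, ← hf] at hb
        exact hb
      rcases node_cases k with rfl | rfl | ⟨j, rfl⟩
      · exact key 0 1 (by simp [Between, node])
      · exact key 1 0 (by simp [Between, node])
      · have hb := between_node ℓ' j
        rw [← h, ← f.apply_symm_apply (.inl 0), ← f.apply_symm_apply (.inl 4), ← hf] at hb
        obtain ⟨i, hi⟩ := hb.exists_node
        cases hi
    · exact ⟨w, rfl⟩
  choose g hg using h2
  refine ⟨σ, hσ', g, fun i z => ?_⟩
  have h := (hf _ _ _).1 (between_reflect ℓ i z)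
  rw [hσ, hg, hg, between_inr_inr] at h
  exact h

theorem intertwining_shift {ℓ ℓ' : Fin 3 → ℝ} {σ : Fin 3 → Fin 3} {g : Bool × ℝ → Bool × ℝ}
    (hg : ∀ i z, g (reflect (ℓ i) z) = reflect (ℓ' (σ i)) (g z)) (i j : Fin 3) (n : ℤ) :
    ∀ z : Bool × ℝ, g (z.1, z.2 + n * (ℓ i - ℓ j)) =
      ((g z).1, (g z).2 + n * (ℓ' (σ i) - ℓ' (σ j))) := by
  have step : ∀ (i j : Fin 3) (z : Bool × ℝ), g (z.1, z.2 + (ℓ i - ℓ j)) =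
      ((g z).1, (g z).2 + (ℓ' (σ i) - ℓ' (σ j))) := by
    intro i j z
    rw [← reflect_reflect, hg, hg, reflect_reflect]
  induction n with
  | zero => intro z; simp
  | succ n ih =>
    intro z
    have h := step i j (z.1, z.2 + (n : ℤ) * (ℓ i - ℓ j))
    rw [ih] at h
    have e : ∀ a b : ℝ, (((n : ℤ) + 1 : ℤ) : ℝ) * (a - b) = ((n : ℤ) : ℝ) * (a - b) + (a - b) := by
      intro a b; push_cast; ring
    rw [e, e, ← add_assoc, ← add_assoc]
    exact h
  | pred n ih =>
    intro z
    have h := step j i (z.1, z.2 + (-n : ℤ) * (ℓ i - ℓ j))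
    rw [ih] at h
    have e : ∀ a b : ℝ, ((-(n : ℤ) - 1 : ℤ) : ℝ) * (a - b) =
        ((-n : ℤ) : ℝ) * (a - b) + (b - a) := by
      intro a b; push_cast; ring
    rw [e, e, ← add_assoc, ← add_assoc]
    exact h

/-- The integral relations between the parameters of the reversions: these turn out to be the
cycles. -/
def IsRelation (ℓ : Fin 3 → ℝ) (v : Fin 3 → ℤ) : Prop :=
  ∑ i, v i = 0 ∧ ∑ i, (v i : ℝ) * ℓ i = 0

theorem isRelation_iff {ℓ : Fin 3 → ℝ} {v : Fin 3 → ℤ} :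
    IsRelation ℓ v ↔ v 1 = -v 0 - v 2 ∧ v 0 * (ℓ 1 - ℓ 0) = v 2 * (ℓ 2 - ℓ 1) := by
  unfold IsRelation
  rw [Fin.sum_univ_three, Fin.sum_univ_three]
  constructor
  · rintro ⟨h, h'⟩
    have h1 : v 1 = -v 0 - v 2 := by linarith
    rw [h1] at h'
    push_cast at h'
    exact ⟨h1, by linarith⟩
  · rintro ⟨h, h'⟩
    refine ⟨by rw [h]; ring, ?_⟩
    rw [h]
    push_cast
    linarith

theorem IsRelation.of_equiv {ℓ ℓ' : Fin 3 → ℝ} {v : Fin 3 → ℤ} (hv : IsRelation ℓ v)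
    (f : Label ≃ Label) (hf : ∀ a c b, Between ℓ a c b ↔ Between ℓ' (f a) (f c) (f b)) :
    IsRelation ℓ' v ∨ IsRelation ℓ' (v ∘ Fin.rev) := by
  obtain ⟨σ, hσ, g, hg⟩ := exists_intertwining f hf
  rw [isRelation_iff] at hv
  obtain ⟨h1, h2⟩ := hv
  have h3 := intertwining_shift hg 2 1 (-v 2)
    ((true, (0 : ℝ)).1, (true, (0 : ℝ)).2 + (v 0 : ℝ) * (ℓ 1 - ℓ 0))
  rw [intertwining_shift hg 1 0 (v 0)] at h3
  have h4 : ((true, (0 : ℝ)).2 + (v 0 : ℝ) * (ℓ 1 - ℓ 0)) + ((-v 2 : ℤ) : ℝ) * (ℓ 2 - ℓ 1) = 0 := by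
    push_cast
    linarith
  simp only [h4] at h3
  have h5 := congrArg Prod.snd h3
  push_cast at h5
  rcases hσ with rfl | rfl
  · left
    rw [isRelation_iff]
    simp only [id] at h5
    exact ⟨h1, by linarith⟩
  · right
    rw [isRelation_iff]
    have r0 : Fin.rev (0 : Fin 3) = 2 := rfl
    have r1 : Fin.rev (1 : Fin 3) = 1 := rfl
    have r2 : Fin.rev (2 : Fin 3) = 0 := rfl
    simp only [r0, r1, r2] at h5
    simp only [Function.comp, r0, r1, r2]
    exact ⟨by linarith, by linarith⟩

/-- An additive automorphism of `ℝ` that matches the differences of the parameters induces an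
isomorphism of the models. -/
theorem exists_model_equiv {ℓ ℓ' : Fin 3 → ℝ} (E : ℝ ≃+ ℝ) (h0 : E (ℓ 1 - ℓ 0) = ℓ' 1 - ℓ' 0)
    (h2 : E (ℓ 2 - ℓ 1) = ℓ' 2 - ℓ' 1) :
    ∃ f : Label ≃ Label, ∀ a c b, Between ℓ a c b ↔ Between ℓ' (f a) (f c) (f b) := by
  -- The translation part makes the second reflections correspond; the others then follow.
  let e : ℝ ≃ ℝ := E.toEquiv.trans (Equiv.addRight ((ℓ' 1 - E (ℓ 1)) / 2))
  have he : ∀ x, e x = E x + (ℓ' 1 - E (ℓ 1)) / 2 := fun x => rfl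
  let g : Bool × ℝ ≃ Bool × ℝ := Equiv.prodCongr (Equiv.refl _) e
  have hE : ∀ i, E (ℓ i) = ℓ' i - ℓ' 1 + E (ℓ 1) := by
    rw [map_sub] at h0 h2
    intro i
    fin_cases i <;> simp <;> linarith
  have hg : ∀ i z, g (reflect (ℓ i) z) = reflect (ℓ' i) (g z) := by
    rintro i ⟨b, x⟩
    simp only [g, reflect, Equiv.prodCongr_apply, Prod.map, Equiv.refl_apply, he, map_sub, hE i,
      Prod.mk.injEq, true_and]
    ring
  refine ⟨Equiv.sumCongr (Equiv.refl _) g, ?_⟩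
  rintro (i | z) (j | y) (k | w) <;> simp only [Equiv.sumCongr_apply, Sum.map_inl, Sum.map_inr,
    Equiv.refl_apply, Between]
  refine exists_congr fun i => and_congr_right fun _ => ?_
  rw [← hg, g.apply_eq_iff_eq]

/-- Any two pairs of reals that are linearly independent over `ℚ` are exchanged by an additive
automorphism of `ℝ`. -/
theorem exists_addEquiv_of_linearIndependent {a b a' b' : ℝ}
    (h : LinearIndependent ℚ ![a, b]) (h' : LinearIndependent ℚ ![a', b']) :
    ∃ E : ℝ ≃+ ℝ, E a = a' ∧ E b = b' := by
  let B := Module.Basis.span h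
  let B' := Module.Basis.span h'
  have : FiniteDimensional ℚ (Submodule.span ℚ (Set.range ![a, b])) :=
    FiniteDimensional.span_of_finite ℚ (Set.finite_range _)
  obtain ⟨E, hE⟩ := Submodule.exists_linearEquiv_restrict_eq (B.equiv B' (Equiv.refl _))
  have key : ∀ i, E (![a, b] i) = ![a', b'] i := by
    intro i
    have h1 := hE (B i)
    rw [Module.Basis.equiv_apply] at h1
    rw [show ((B i : Submodule.span ℚ (Set.range ![a, b])) : ℝ) = ![a, b] i from
      congrArg _ (Module.Basis.span_apply h i)] at h1
    rw [← h1]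
    exact congrArg Subtype.val (Module.Basis.span_apply h' i)
  exact ⟨E.toAddEquiv, key 0, key 1⟩

/-- Without nonzero relations, the two gaps between the parameters are linearly independent. -/
theorem linearIndependent_of_relations {ℓ : Fin 3 → ℝ} (h : ∀ v, IsRelation ℓ v → v = 0) :
    LinearIndependent ℚ ![ℓ 1 - ℓ 0, ℓ 2 - ℓ 1] := by
  rw [← LinearIndependent.iff_fractionRing ℤ ℚ, LinearIndependent.pair_iff]
  intro m n hmn
  have h1 := h ![m, -m + n, -n] (by
    rw [isRelation_iff]
    simp only [zsmul_eq_mul] at hmn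
    refine ⟨by simp, ?_⟩
    simp only [Matrix.cons_val]
    push_cast
    linarith)
  have h0 := congrFun h1 0
  have h2 := congrFun h1 2
  simp at h0 h2
  exact ⟨h0, h2⟩

theorem exists_model_equiv_of_no_relations {ℓ ℓ' : Fin 3 → ℝ}
    (h : ∀ v, IsRelation ℓ v → v = 0) (h' : ∀ v, IsRelation ℓ' v → v = 0) :
    ∃ f : Label ≃ Label, ∀ a c b, Between ℓ a c b ↔ Between ℓ' (f a) (f c) (f b) := by
  obtain ⟨E, h0, h2⟩ := exists_addEquiv_of_linearIndependent
    (linearIndependent_of_relations h) (linearIndependent_of_relations h')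
  exact exists_model_equiv E h0 h2

/-- A common relation means that the gaps are proportional, so a homothety matches them. -/
theorem exists_model_equiv_of_common_relation {ℓ ℓ' : Fin 3 → ℝ} (hℓ : StrictMono ℓ)
    (hℓ' : StrictMono ℓ') {v : Fin 3 → ℤ} (hv2 : v 2 ≠ 0) (h : IsRelation ℓ v)
    (h' : IsRelation ℓ' v) :
    ∃ f : Label ≃ Label, ∀ a c b, Between ℓ a c b ↔ Between ℓ' (f a) (f c) (f b) := by
  rw [isRelation_iff] at h h'
  have a0 : 0 < ℓ 1 - ℓ 0 := sub_pos.2 (hℓ (by decide))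
  have a1 : 0 < ℓ' 1 - ℓ' 0 := sub_pos.2 (hℓ' (by decide))
  have hv : (v 2 : ℝ) ≠ 0 := by exact_mod_cast hv2
  let c : ℝˣ := Units.mk0 ((ℓ' 1 - ℓ' 0) / (ℓ 1 - ℓ 0)) (div_pos a1 a0).ne'
  refine exists_model_equiv (LinearEquiv.smulOfUnit (M := ℝ) c).toAddEquiv ?_ ?_
  · change (ℓ' 1 - ℓ' 0) / (ℓ 1 - ℓ 0) * (ℓ 1 - ℓ 0) = _
    field_simp
  · change (ℓ' 1 - ℓ' 0) / (ℓ 1 - ℓ 0) * (ℓ 2 - ℓ 1) = _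
    apply mul_left_cancel₀ hv
    rw [← h'.2, mul_left_comm, ← h.2]
    field_simp

/-! ### Cycles of a parametrized code -/

/-- `Ψ` labels the points of the set of the code `s` in such a way that betweenness becomes the
relation `Between ℓ`. -/
structure IsParam (s : Code 3) (ℓ : Fin 3 → ℝ) (Ψ : Label → Plane) : Prop where
  mono : StrictMono ℓ
  inj : Function.Injective Ψ
  range_eq : Set.range Ψ = s.toSet
  apply_node : ∀ i, Ψ (.inl (node i)) = s.pt i
  mem_circle : ∀ z, Ψ (.inr z) ∈ s.circle
  sbtw_iff : ∀ a c b, Sbtw ℝ (Ψ a) (Ψ c) (Ψ b) ↔ Between ℓ a c b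

theorem IsParam.range_pt_subset {s : Code 3} {ℓ : Fin 3 → ℝ} {Ψ : Label → Plane}
    (h : IsParam s ℓ Ψ) : Set.range s.pt ⊆ Set.range (fun i => Ψ (.inl i)) := by
  rintro _ ⟨i, rfl⟩
  exact ⟨node i, h.apply_node i⟩

/-- The collinear hull of the interior points consists of the points on their line. -/
theorem IsParam.collinearHull_eq {s : Code 3} {ℓ : Fin 3 → ℝ} {Ψ : Label → Plane}
    (h : IsParam s ℓ Ψ) :
    collinearHull s.toSet (Set.range s.pt) = Set.range (fun i => Ψ (.inl i)) := by
  apply Set.Subset.antisymm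
  · apply Set.sInter_subset_of_mem
    refine ⟨h.range_pt_subset, ?_, ?_⟩
    · rintro _ ⟨i, rfl⟩
      rw [← h.range_eq]
      exact ⟨_, rfl⟩
    · rintro c hc _ ⟨⟨i, rfl⟩, hi⟩ _ ⟨⟨j, rfl⟩, hj⟩ hij hcol
      rw [← h.range_eq] at hc
      obtain ⟨k | z, rfl⟩ := hc
      · exact ⟨k, rfl⟩
      exfalso
      have hi' : Ψ (.inl i) ≠ Ψ (.inr z) := hi
      have hj' : Ψ (.inl j) ≠ Ψ (.inr z) := hj
      rcases hcol.wbtw_or_wbtw_or_wbtw with hw | hw | hw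
      · exact (h.sbtw_iff _ _ _).1 ⟨hw, hij.symm, hj'⟩
      · exact (h.sbtw_iff _ _ _).1 ⟨hw, hj'.symm, hi'.symm⟩
      · exact (h.sbtw_iff _ _ _).1 ⟨hw, hi', hij⟩
  · rintro _ ⟨k, rfl⟩ B ⟨hAB, -, hB⟩
    have hn : ∀ j, Ψ (.inl (node j)) ∈ B := fun j => hAB ⟨j, (h.apply_node j).symm⟩
    have key : ∀ (a b k : Fin 5), a ≠ k → b ≠ k → a ≠ b → (k < a ∧ a < b) ∨ (b < a ∧ a < k) →
        Ψ (.inl a) ∈ B → Ψ (.inl b) ∈ B → Ψ (.inl k) ∈ B := by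
      intro a b k hak hbk hab hlt ha hb
      have hne : ∀ {i j : Fin 5}, i ≠ j → Ψ (.inl i) ≠ Ψ (.inl j) := fun hij he =>
        hij (Sum.inl_injective (h.inj he))
      refine hB _ (by rw [← h.range_eq]; exact ⟨_, rfl⟩) _ ⟨ha, hne hak⟩ _ ⟨hb, hne hbk⟩
        (hne hab) ?_
      have hc := ((h.sbtw_iff (.inl k) (.inl a) (.inl b)).2 hlt).wbtw.collinear
      refine hc.subset ?_
      rintro x (rfl | rfl | rfl) <;> simp
    rcases node_cases k with rfl | rfl | ⟨j, rfl⟩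
    · exact key (node 0) (node 1) 0 (by decide) (by decide) (by decide) (by decide) (hn _) (hn _)
    · exact key (node 1) (node 0) 4 (by decide) (by decide) (by decide) (by decide) (hn _) (hn _)
    · exact hn j

theorem IsParam.mem_diff_iff {s : Code 3} {ℓ : Fin 3 → ℝ} {Ψ : Label → Plane}
    (h : IsParam s ℓ Ψ) {c : Plane} :
    c ∈ (s.circle : Set Plane) \ collinearHull s.toSet (Set.range s.pt) ↔
      ∃ z, c = Ψ (.inr z) := by
  rw [h.collinearHull_eq]
  constructor
  · rintro ⟨hc, hc'⟩
    have : c ∈ Set.range Ψ := by rw [h.range_eq]; exact Or.inl hc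
    obtain ⟨i | z, rfl⟩ := this
    · exact absurd ⟨i, rfl⟩ hc'
    · exact ⟨z, rfl⟩
  · rintro ⟨z, rfl⟩
    refine ⟨h.mem_circle z, ?_⟩
    rintro ⟨i, hi⟩
    cases h.inj hi

theorem IsParam.reversion_apply {s : Code 3} {ℓ : Fin 3 → ℝ} {Ψ : Label → Plane}
    (h : IsParam s ℓ Ψ) (i : Fin 3) (z : Bool × ℝ) :
    reversion s.circle (s.pt i) (Ψ (.inr z)) = Ψ (.inr (reflect (ℓ i) z)) := by
  symm
  rw [eq_reversion_iff (s.interior i) (h.mem_circle z), ← h.apply_node i, h.sbtw_iff]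
  exact ⟨h.mem_circle _, between_reflect ℓ i z⟩

/-- The signature of a list of indices, computed recursively. -/
def listSignature {l : ℕ} : List (Fin l) → Fin l → ℤ
  | [], _ => 0
  | a :: g, i => (if a = i then 1 else 0) - listSignature g i

theorem signature_eq {l : ℕ} (g : Irreducibles l) : signature g = listSignature g.1 := by
  have key : ∀ (g : List (Fin l)) (i : Fin l),
      ∑ m : Fin g.length, (if g.get m = i then (-1 : ℤ) ^ (m : ℕ) else 0) =
        listSignature g i := by
    intro g i
    induction g with
    | nil => rfl
    | cons a g ih =>
      simp only [listSignature, ← ih, List.length_cons, Fin.sum_univ_succ, sub_eq_add_neg,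
        ← Finset.sum_neg_distrib]
      congr 1
      refine Finset.sum_congr rfl fun m _ => ?_
      rw [show (a :: g).get m.succ = g.get m from rfl, Fin.val_succ, pow_succ]
      split_ifs <;> simp
  funext i
  exact key g.1 i

theorem sum_listSignature {l : ℕ} (g : List (Fin l)) :
    ∑ i, listSignature g i = if Even g.length then 0 else 1 := by
  induction g with
  | nil => simp [listSignature]
  | cons a g ih =>
    simp only [listSignature, Finset.sum_sub_distrib, ih, List.length_cons, Nat.even_add_one]
    by_cases h : Even g.length <;> simp [h]

/-- The action of a list of indices is a translation or a reflection, by an amount that only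
depends on the signature. -/
theorem foldl_reflect (ℓ : Fin 3 → ℝ) (g : List (Fin 3)) (z : Bool × ℝ) :
    g.foldl (fun w i => reflect (ℓ i) w) z =
      if Even g.length then (z.1, z.2 - ∑ i, (listSignature g i : ℝ) * ℓ i)
      else reflect (∑ i, (listSignature g i : ℝ) * ℓ i) z := by
  induction g generalizing z with
  | nil => simp [listSignature]
  | cons a g ih =>
    have hs : ∑ i, (listSignature (a :: g) i : ℝ) * ℓ i =
        ℓ a - ∑ i, (listSignature g i : ℝ) * ℓ i := by
      simp [listSignature, sub_mul, Finset.sum_sub_distrib]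
    rw [List.foldl_cons, ih, List.length_cons, hs]
    by_cases h : Even g.length
    · rw [if_pos h, if_neg (by simpa [Nat.even_add_one] using h)]
      simp only [reflect, Prod.mk.injEq, true_and]
      ring
    · rw [if_neg h, if_pos (by simpa [Nat.even_add_one] using h)]
      simp only [reflect, Bool.not_not, Prod.mk.injEq, true_and]
      ring

theorem IsParam.act_apply {s : Code 3} {ℓ : Fin 3 → ℝ} {Ψ : Label → Plane}
    (h : IsParam s ℓ Ψ) (g : Irreducibles 3) (z : Bool × ℝ) :
    s.act (Ψ (.inr z)) g = Ψ (.inr (g.1.foldl (fun w i => reflect (ℓ i) w) z)) := by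
  have key : ∀ (g : List (Fin 3)) (z : Bool × ℝ),
      g.foldl (fun x i => reversion s.circle (s.pt i) x) (Ψ (.inr z)) =
        Ψ (.inr (g.foldl (fun w i => reflect (ℓ i) w) z)) := by
    intro g
    induction g with
    | nil => intro z; rfl
    | cons a g ih =>
      intro z
      rw [List.foldl_cons, h.reversion_apply, ih, List.foldl_cons]
  exact key g.1 z

/-- Every vector with sum zero is a signature: alternate between indices of positive and of
negative entries. -/
theorem exists_signature_eq {l : ℕ} (v : Fin l → ℤ) (hv : ∑ i, v i = 0) :
    ∃ g : Irreducibles l, signature g = v := by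
  have key : ∀ (n : ℕ) (v : Fin l → ℤ), ∑ i, v i = 0 → ∑ i, (v i).natAbs = n →
      ∃ g : List (Fin l), g.IsChain (· ≠ ·) ∧ listSignature g = v ∧ ∀ a ∈ g.head?, 0 < v a := by
    intro n
    induction n using Nat.strong_induction_on with
    | _ n ih =>
      intro v hv hn
      by_cases h0 : v = 0
      · subst h0
        exact ⟨[], by simp, rfl, by simp⟩
      obtain ⟨i, hi⟩ := Function.ne_iff.1 h0
      obtain ⟨a, -, ha⟩ := Finset.exists_pos_of_sum_zero_of_exists_nonzero v hv
        ⟨i, Finset.mem_univ i, hi⟩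
      obtain ⟨b, -, hb⟩ := Finset.exists_pos_of_sum_zero_of_exists_nonzero (fun i => -v i)
        (by rw [Finset.sum_neg_distrib, hv, neg_zero])
        ⟨i, Finset.mem_univ i, neg_ne_zero.2 hi⟩
      have hb : v b < 0 := by linarith
      have hab : a ≠ b := by rintro rfl; linarith
      let w : Fin l → ℤ := fun i => v i - ((if a = i then 1 else 0) - (if b = i then 1 else 0))
      have hw : ∑ i, w i = 0 := by
        simp [w, Finset.sum_sub_distrib, hv]
      have hlt : ∑ i, (w i).natAbs < n := by
        rw [← hn]
        apply Finset.sum_lt_sum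
        · intro i _
          simp only [w]
          split_ifs with h1 h2 h2 <;> (try subst h1) <;> (try subst h2) <;> omega
        · refine ⟨a, Finset.mem_univ a, ?_⟩
          simp only [w, if_true, if_neg hab.symm]
          omega
      obtain ⟨g, hg, hgw, hhead⟩ := ih _ hlt w hw rfl
      refine ⟨a :: b :: g, ?_, ?_, ?_⟩
      · rw [List.isChain_cons_cons]
        refine ⟨hab, ?_⟩
        rw [List.isChain_cons]
        refine ⟨fun c hc => ?_, hg⟩
        have := hhead c hc
        rintro rfl
        simp only [w, if_true, if_neg hab] at this
        omega
      · funext i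
        simp only [listSignature, hgw, w]
        ring
      · simp only [List.head?_cons, Option.mem_def, Option.some.injEq]
        rintro _ rfl
        exact ha
  obtain ⟨g, hg, hgv, -⟩ := key _ v hv rfl
  exact ⟨⟨g, hg⟩, (signature_eq _).trans hgv⟩

/-- The cycles are the integral relations with sum zero between the parameters. -/
theorem IsParam.isCycle_iff {s : Code 3} {ℓ : Fin 3 → ℝ} {Ψ : Label → Plane}
    (h : IsParam s ℓ Ψ) {v : Fin 3 → ℤ} : IsCycle s v ↔ IsRelation ℓ v := by
  constructor
  · rintro ⟨g, c, hc, rfl, hact⟩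
    obtain ⟨z, rfl⟩ := h.mem_diff_iff.1 hc
    rw [h.act_apply, foldl_reflect] at hact
    have hz := Sum.inr_injective (h.inj hact)
    rw [signature_eq]
    by_cases he : Even g.1.length
    · rw [if_pos he] at hz
      have h2 := congrArg Prod.snd hz
      refine ⟨by rw [sum_listSignature, if_pos he], ?_⟩
      simpa using h2
    · -- An odd number of reversions exchanges the two sides of the line.
      rw [if_neg he] at hz
      have h1 := congrArg Prod.fst hz
      simp [reflect] at h1
  · rintro ⟨h0, h1⟩
    obtain ⟨g, hg⟩ := exists_signature_eq v h0
    refine ⟨g, Ψ (.inr (true, 0)), h.mem_diff_iff.2 ⟨_, rfl⟩, hg, ?_⟩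
    rw [signature_eq] at hg
    have he : Even g.1.length := by
      by_contra hne
      have := sum_listSignature g.1
      rw [hg, h0, if_neg hne] at this
      exact absurd this (by norm_num)
    rw [h.act_apply, foldl_reflect, if_pos he, hg, h1, sub_zero]

/-! ### Isomorphisms of parametrized codes -/

theorem IsParam.betweennessIsomorphic_iff {s s' : Code 3} {ℓ ℓ' : Fin 3 → ℝ}
    {Ψ Ψ' : Label → Plane} (h : IsParam s ℓ Ψ) (h' : IsParam s' ℓ' Ψ') :
    BetweennessIsomorphic s.toSet s'.toSet ↔
      ∃ f : Label ≃ Label, ∀ a c b, Between ℓ a c b ↔ Between ℓ' (f a) (f c) (f b) := by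
  let e : Label ≃ s.toSet := (Equiv.ofInjective Ψ h.inj).trans (Equiv.setCongr h.range_eq)
  let e' : Label ≃ s'.toSet := (Equiv.ofInjective Ψ' h'.inj).trans (Equiv.setCongr h'.range_eq)
  have he : ∀ a, (e a : Plane) = Ψ a := fun a => rfl
  have he' : ∀ a, (e' a : Plane) = Ψ' a := fun a => rfl
  constructor
  · rintro ⟨f, hf⟩
    refine ⟨(e.trans f).trans e'.symm, fun a c b => ?_⟩
    have key := hf (e a) (e b) (e c)
    rw [he, he, he, h.sbtw_iff] at key
    rw [key, ← h'.sbtw_iff, ← he', ← he', ← he']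
    simp
  · rintro ⟨f, hf⟩
    refine ⟨(e.symm.trans f).trans e', fun a b c => ?_⟩
    have key := hf (e.symm a) (e.symm c) (e.symm b)
    rw [← h.sbtw_iff, ← h'.sbtw_iff, ← he, ← he, ← he, ← he', ← he', ← he'] at key
    simpa using key

/-- The code with the interior points listed in the opposite order. -/
def Code.rev (s : Code 3) : Code 3 where
  circle := s.circle
  radius_pos := s.radius_pos
  pt := s.pt ∘ Fin.rev
  interior i := s.interior _
  ordered := by
    obtain ⟨q, d, t, hd, ht, hpt⟩ := s.ordered
    refine ⟨q, d, t ∘ Fin.rev, hd, ?_, fun i => hpt _⟩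
    rcases ht with ht | ht
    · exact Or.inr (ht.comp_strictAnti Fin.rev_strictAnti)
    · exact Or.inl (ht.comp Fin.rev_strictAnti)

theorem Code.rev_toSet (s : Code 3) : s.rev.toSet = s.toSet := by
  have : Set.range s.rev.pt = Set.range s.pt := Fin.rev_surjective.range_comp s.pt
  rw [Code.toSet, this]
  rfl

/-- Reversing the order of the interior points negates the parameters. -/
theorem IsParam.rev {s : Code 3} {ℓ : Fin 3 → ℝ} {Ψ : Label → Plane} (h : IsParam s ℓ Ψ) :
    ∃ Ψ', IsParam s.rev (fun i => -ℓ i.rev) Ψ' := by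
  let e : Label ≃ Label :=
    Equiv.sumCongr Fin.revPerm (Equiv.prodCongr (Equiv.refl _) (Equiv.neg ℝ))
  refine ⟨Ψ ∘ e, fun i j hij => neg_lt_neg (h.mono (Fin.rev_lt_rev.2 hij)),
    h.inj.comp e.injective, ?_, fun i => ?_, fun z => h.mem_circle _, fun a c b => ?_⟩
  · rw [e.surjective.range_comp, h.range_eq, Code.rev_toSet]
  · have : Fin.rev (node i) = node i.rev := by revert i; decide
    change Ψ (.inl (Fin.rev (node i))) = s.pt i.rev
    rw [this, h.apply_node]
  · simp only [Function.comp, h.sbtw_iff]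
    rcases a with i | z <;> rcases c with j | y <;> rcases b with k | w <;>
      simp only [e, Equiv.sumCongr_apply, Sum.map_inl, Sum.map_inr, Between, Fin.revPerm_apply,
        Fin.rev_lt_rev]
    · tauto
    · constructor
      · rintro ⟨i, hi, hw⟩
        refine ⟨i.rev, ?_, ?_⟩
        · have : ∀ (j : Fin 5) (i : Fin 3), j.rev = node i → j = node i.rev := by decide
          exact this j i hi
        · simp only [reflect, Equiv.prodCongr_apply, Prod.map, Equiv.refl_apply, Equiv.neg_apply,
            Prod.ext_iff, Fin.rev_rev] at hw ⊢
          exact ⟨hw.1, by linarith [hw.2]⟩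
      · rintro ⟨i, hi, hw⟩
        refine ⟨i.rev, ?_, ?_⟩
        · have : ∀ (j : Fin 5) (i : Fin 3), j = node i → j.rev = node i.rev := by decide
          exact this j i hi
        · simp only [reflect, Equiv.prodCongr_apply, Prod.map, Equiv.refl_apply, Equiv.neg_apply,
            Prod.ext_iff] at hw ⊢
          exact ⟨hw.1, by linarith [hw.2]⟩

theorem isRelation_neg_rev {ℓ : Fin 3 → ℝ} {v : Fin 3 → ℤ} :
    IsRelation (fun i => -ℓ i.rev) v ↔ IsRelation ℓ (v ∘ Fin.rev) := by
  unfold IsRelation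
  simp only [Function.comp, Fin.sum_univ_three, show Fin.rev (0 : Fin 3) = 2 from rfl,
    show Fin.rev (1 : Fin 3) = 1 from rfl, show Fin.rev (2 : Fin 3) = 0 from rfl]
  constructor <;> rintro ⟨h1, h2⟩ <;> exact ⟨by linarith, by linarith⟩

/-! ### Coordinates on the circle -/

/-- The orthonormal coordinate system with origin `M` and first basis vector `u`. -/
noncomputable def frame (M u : Plane) (hu : u 0 ^ 2 + u 1 ^ 2 = 1) : (ℝ × ℝ) ≃ᵃ[ℝ] Plane :=
  (LinearEquiv.toAffineEquiv (k := ℝ)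
    { toFun := fun a => !₂[a.1 * u 0 - a.2 * u 1, a.1 * u 1 + a.2 * u 0]
      invFun := fun X => (X 0 * u 0 + X 1 * u 1, X 1 * u 0 - X 0 * u 1)
      map_add' := fun a b => by ext i; fin_cases i <;> simp <;> ring
      map_smul' := fun c a => by ext i; fin_cases i <;> simp <;> ring
      left_inv := fun a => by
        ext
        · simp; linear_combination a.1 * hu
        · simp; linear_combination a.2 * hu
      right_inv := fun X => by
        ext i
        fin_cases i
        · simp; linear_combination X 0 * hu
        · simp; linear_combination X 1 * hu }).trans (AffineEquiv.vaddConst ℝ M)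

theorem frame_zero (M u : Plane) (hu : u 0 ^ 2 + u 1 ^ 2 = 1) (a : ℝ × ℝ) :
    frame M u hu a 0 = a.1 * u 0 - a.2 * u 1 + M 0 := by
  simp [frame]

theorem frame_one (M u : Plane) (hu : u 0 ^ 2 + u 1 ^ 2 = 1) (a : ℝ × ℝ) :
    frame M u hu a 1 = a.1 * u 1 + a.2 * u 0 + M 1 := by
  simp [frame]

theorem dist_frame_sq (M u : Plane) (hu : u 0 ^ 2 + u 1 ^ 2 = 1) (a b : ℝ × ℝ) :
    dist (frame M u hu a) (frame M u hu b) ^ 2 = (a.1 - b.1) ^ 2 + (a.2 - b.2) ^ 2 := by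
  rw [EuclideanSpace.dist_eq, Real.sq_sqrt (by positivity), Fin.sum_univ_two, Real.dist_eq,
    Real.dist_eq, sq_abs, sq_abs, frame_zero, frame_zero, frame_one, frame_one]
  linear_combination ((a.1 - b.1) ^ 2 + (a.2 - b.2) ^ 2) * hu

/-- The affine coordinates `T` are orthonormal, and the code has in them its interior points
`(p i, 0)`, its center `(0, k)`, and the end points `(-h, 0)` and `(h, 0)` of the chord through the
interior points. -/
structure IsAdapted (s : Code 3) (T : (ℝ × ℝ) ≃ᵃ[ℝ] Plane) (h k : ℝ) (p : Fin 3 → ℝ) : Prop where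
  dist_sq : ∀ a b, dist (T a) (T b) ^ 2 = (a.1 - b.1) ^ 2 + (a.2 - b.2) ^ 2
  pos : 0 < h
  center : s.circle.center = T (0, k)
  radius_sq : s.circle.radius ^ 2 = h ^ 2 + k ^ 2
  pt : ∀ i, s.pt i = T (p i, 0)
  mono : StrictMono p
  left_lt : ∀ i, -h < p i
  lt_right : ∀ i, p i < h

theorem Code.exists_isAdapted (s : Code 3) : ∃ T h k p, IsAdapted s T h k p := by
  obtain ⟨q, d, t, hd, ht, hpt⟩ : ∃ (q d : Plane) (t : Fin 3 → ℝ), d ≠ 0 ∧ StrictMono t ∧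
      ∀ i, s.pt i = q + t i • d := by
    obtain ⟨q, d, t, hd, ht | ht, hpt⟩ := s.ordered
    · exact ⟨q, d, t, hd, ht, hpt⟩
    · exact ⟨q, -d, fun i => -t i, neg_ne_zero.2 hd, ht.neg, fun i => by simp [hpt i]⟩
  have hL : 0 < ‖d‖ := norm_pos_iff.2 hd
  have hL2 : d 0 ^ 2 + d 1 ^ 2 = ‖d‖ ^ 2 := by
    rw [EuclideanSpace.norm_eq, Real.sq_sqrt (by positivity), Fin.sum_univ_two, Real.norm_eq_abs,
      Real.norm_eq_abs, sq_abs, sq_abs]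
  obtain ⟨u, hdu⟩ : ∃ u : Plane, d = ‖d‖ • u := ⟨‖d‖⁻¹ • d, by
    rw [smul_smul, mul_inv_cancel₀ hL.ne', one_smul]⟩
  have hd0 : d 0 = ‖d‖ * u 0 := congrArg (fun X : Plane => X 0) hdu
  have hd1 : d 1 = ‖d‖ * u 1 := congrArg (fun X : Plane => X 1) hdu
  have hu : u 0 ^ 2 + u 1 ^ 2 = 1 := by
    rw [hd0, hd1] at hL2
    have : ‖d‖ ^ 2 * (u 0 ^ 2 + u 1 ^ 2 - 1) = 0 := by linear_combination hL2
    rcases mul_eq_zero.1 this with h | h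
    · exact absurd h (by positivity)
    · linarith
  set O := s.circle.center with hO
  obtain ⟨k, hk⟩ : ∃ k, k = (O 1 - q 1) * u 0 - (O 0 - q 0) * u 1 := ⟨_, rfl⟩
  obtain ⟨e, he⟩ : ∃ e, e = (O 0 - q 0) * u 0 + (O 1 - q 1) * u 1 := ⟨_, rfl⟩
  -- The origin is the foot of the perpendicular from the center to the line.
  let T := frame !₂[O 0 + k * u 1, O 1 - k * u 0] u hu
  have hcenter : O = T (0, k) := by
    ext i
    fin_cases i
    · simp [T, frame_zero]
    · simp [T, frame_one]
  have hp : ∀ i, s.pt i = T (t i * ‖d‖ - e, 0) := by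
    intro i
    ext j
    rw [hpt i]
    fin_cases j
    · simp only [T, Fin.zero_eta, frame_zero, PiLp.add_apply, PiLp.smul_apply, smul_eq_mul, hd0,
        he, hk]
      simp
      linear_combination (O 0 - q 0) * hu
    · simp only [T, Fin.mk_one, frame_one, PiLp.add_apply, PiLp.smul_apply, smul_eq_mul, hd1,
        he, hk]
      simp
      linear_combination (O 1 - q 1) * hu
  have hlt : ∀ i, (t i * ‖d‖ - e) ^ 2 + k ^ 2 < s.circle.radius ^ 2 := by
    intro i
    have h1 := s.interior i
    have h2 := pow_lt_pow_left₀ h1 dist_nonneg two_ne_zero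
    rw [← hO, hp i, hcenter, dist_frame_sq] at h2
    simpa using h2
  have hr : 0 < s.circle.radius ^ 2 - k ^ 2 := by
    have := hlt 0
    nlinarith [sq_nonneg (t 0 * ‖d‖ - e)]
  have habs : ∀ i, |t i * ‖d‖ - e| < √(s.circle.radius ^ 2 - k ^ 2) := fun i => by
    apply Real.lt_sqrt_of_sq_lt
    rw [sq_abs]
    linarith [hlt i]
  exact ⟨T, √(s.circle.radius ^ 2 - k ^ 2), k, fun i => t i * ‖d‖ - e,
    { dist_sq := dist_frame_sq _ _ _
      pos := Real.sqrt_pos.2 hr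
      center := hcenter
      radius_sq := by rw [Real.sq_sqrt hr.le]; ring
      pt := hp
      mono := fun i j hij => sub_lt_sub_right (mul_lt_mul_of_pos_right (ht hij) hL) _
      left_lt := fun i => (abs_lt.1 (habs i)).1
      lt_right := fun i => (abs_lt.1 (habs i)).2 }⟩

/-- The point of the circle with center `(0, k)` and radius `r` whose distances from the end points
`(-h, 0)` and `(h, 0)` of a chord have the ratio `|m|`, on the side of the chord given by the sign
of `m`. -/
noncomputable def circlePoint (h k r m : ℝ) : ℝ × ℝ :=
  (h * r * (m ^ 2 - 1) / (r * (m ^ 2 + 1) - 2 * k * m),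
    2 * h ^ 2 * m / (r * (m ^ 2 + 1) - 2 * k * m))

section circlePoint

variable {h k r : ℝ} (hh : 0 < h) (hr : 0 < r) (hhk : r ^ 2 = h ^ 2 + k ^ 2)

include hh hr hhk

theorem circlePoint_denom_pos (m : ℝ) : 0 < r * (m ^ 2 + 1) - 2 * k * m := by
  have : 0 < r * (r * (m ^ 2 + 1) - 2 * k * m) := by
    have : r * (r * (m ^ 2 + 1) - 2 * k * m) = (r * m - k) ^ 2 + h ^ 2 := by
      linear_combination hhk
    rw [this]
    positivity
  exact pos_of_mul_pos_right this hr.le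

theorem circlePoint_mem (m : ℝ) : (circlePoint h k r m).1 ^ 2 + (circlePoint h k r m).2 ^ 2 -
    2 * k * (circlePoint h k r m).2 = h ^ 2 := by
  have hD := (circlePoint_denom_pos hh hr hhk m).ne'
  obtain ⟨D, hDm⟩ : ∃ D, D = r * (m ^ 2 + 1) - 2 * k * m := ⟨_, rfl⟩
  rw [← hDm] at hD
  simp only [circlePoint, ← hDm]
  field_simp
  rw [hDm]
  linear_combination (-4 * m ^ 2) * hhk

theorem circlePoint_snd_ne_zero {m : ℝ} (hm : m ≠ 0) : (circlePoint h k r m).2 ≠ 0 := by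
  have hD := (circlePoint_denom_pos hh hr hhk m).ne'
  simp only [circlePoint]
  positivity

theorem circlePoint_param {m : ℝ} (hm : m ≠ 0) :
    m = (h * ((circlePoint h k r m).1 + h) + k * (circlePoint h k r m).2) /
      (r * (circlePoint h k r m).2) := by
  have hD := (circlePoint_denom_pos hh hr hhk m).ne'
  rw [eq_div_iff (mul_ne_zero hr.ne' (circlePoint_snd_ne_zero hh hr hhk hm))]
  obtain ⟨D, hDm⟩ : ∃ D, D = r * (m ^ 2 + 1) - 2 * k * m := ⟨_, rfl⟩
  rw [← hDm] at hD
  simp only [circlePoint, ← hDm]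
  field_simp
  rw [hDm]
  ring

theorem exists_circlePoint_eq {x y : ℝ} (hy : y ≠ 0) (hxy : x ^ 2 + y ^ 2 - 2 * k * y = h ^ 2) :
    ∃ m, m ≠ 0 ∧ circlePoint h k r m = (x, y) := by
  obtain ⟨N, hN⟩ : ∃ N, N = h * (x + h) + k * y := ⟨_, rfl⟩
  have hN2 : 2 * N = (x + h) ^ 2 + y ^ 2 := by rw [hN]; linear_combination -hxy
  have hN0 : N ≠ 0 := by
    have : 0 < (x + h) ^ 2 + y ^ 2 := by positivity
    intro h0
    rw [h0] at hN2
    linarith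
  have hD : r * ((N / (r * y)) ^ 2 + 1) - 2 * k * (N / (r * y)) = 2 * h ^ 2 * N / (r * y ^ 2) := by
    field_simp
    rw [hN]
    linear_combination y ^ 2 * hhk + h ^ 2 * hxy
  refine ⟨N / (r * y), by positivity, ?_⟩
  rw [circlePoint, hD]
  ext
  · field_simp
    rw [hN]
    linear_combination -y ^ 2 * hhk - h ^ 2 * hxy
  · field_simp

/-- The reversion through `(p, 0)` takes the parameter `m` to `-((h + p) / (h - p)) / m`. -/
theorem sbtw_circlePoint {p m m' : ℝ} (hp : -h < p) (hp' : p < h) (hm : m ≠ 0)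
    (hmm : m * m' * (h - p) = -(h + p)) :
    Sbtw ℝ (circlePoint h k r m) (p, 0) (circlePoint h k r m') := by
  have hD := circlePoint_denom_pos hh hr hhk m
  have hD' := circlePoint_denom_pos hh hr hhk m'
  have hneg : m * m' < 0 := by
    by_contra hcon
    have := mul_nonneg (not_lt.1 hcon) (sub_pos.2 hp').le
    linarith
  have hm' : m' ≠ 0 := by rintro rfl; simp at hneg
  have hy := circlePoint_snd_ne_zero hh hr hhk hm
  have hy' := circlePoint_snd_ne_zero hh hr hhk hm'
  have hyy : (circlePoint h k r m).2 * (circlePoint h k r m').2 < 0 := by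
    simp only [circlePoint]
    rw [div_mul_div_comm]
    refine div_neg_of_neg_of_pos ?_ (by positivity)
    have : 0 < 4 * h ^ 4 := by positivity
    nlinarith
  have hx : (circlePoint h k r m).1 * (circlePoint h k r m').2 -
      (circlePoint h k r m').1 * (circlePoint h k r m).2 =
      p * ((circlePoint h k r m').2 - (circlePoint h k r m).2) := by
    obtain ⟨D, hDm⟩ : ∃ D, D = r * (m ^ 2 + 1) - 2 * k * m := ⟨_, rfl⟩
    obtain ⟨D', hDm'⟩ : ∃ D, D = r * (m' ^ 2 + 1) - 2 * k * m' := ⟨_, rfl⟩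
    rw [← hDm] at hD
    rw [← hDm'] at hD'
    simp only [circlePoint, ← hDm, ← hDm']
    field_simp
    rw [hDm, hDm']
    linear_combination (m - m') * r * hmm
  generalize circlePoint h k r m = a at *
  generalize circlePoint h k r m' = b at *
  obtain ⟨x, y⟩ := a
  obtain ⟨x', y'⟩ := b
  simp only at *
  have hne : y - y' ≠ 0 := by
    intro h0
    rw [sub_eq_zero.1 h0] at hyy
    nlinarith [mul_self_nonneg y']
  refine ⟨⟨y / (y - y'), ?_, ?_⟩, ?_, ?_⟩
  · rcases lt_or_gt_of_ne hy with h0 | h0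
    · have : 0 < y' := by by_contra hc; nlinarith
      exact ⟨div_nonneg_of_nonpos h0.le (by linarith), by
        rw [div_le_one_of_neg (by linarith)]; linarith⟩
    · have : y' < 0 := by by_contra hc; nlinarith
      exact ⟨div_nonneg h0.le (by linarith), by
        rw [div_le_one (by linarith)]; linarith⟩
  · ext
    · simp [AffineMap.lineMap_apply]
      field_simp
      linear_combination -hx
    · simp [AffineMap.lineMap_apply]
      field_simp
      ring
  · exact fun he => hy (congrArg Prod.snd he).symm
  · exact fun he => hy' (congrArg Prod.snd he).symm

end circlePoint

theorem sbtw_real_iff {x y z : ℝ} : Sbtw ℝ x y z ↔ (x < y ∧ y < z) ∨ (z < y ∧ y < x) := by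
  constructor
  · rintro ⟨hw, h1, h2⟩
    rcases le_total x z with h | h
    · obtain ⟨h3, h4⟩ := (wbtw_iff_of_le h).1 hw
      exact Or.inl ⟨lt_of_le_of_ne h3 h1.symm, lt_of_le_of_ne h4 h2⟩
    · obtain ⟨h3, h4⟩ := (wbtw_iff_of_le h).1 hw.symm
      exact Or.inr ⟨lt_of_le_of_ne h3 h2.symm, lt_of_le_of_ne h4 h1⟩
  · rintro (⟨h1, h2⟩ | ⟨h1, h2⟩)
    · exact Sbtw.of_lt_of_lt h1 h2
    · exact (Sbtw.of_lt_of_lt h1 h2).symm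

theorem sbtw_axis_iff {x y z : ℝ} :
    Sbtw ℝ ((x, 0) : ℝ × ℝ) (y, 0) (z, 0) ↔ Sbtw ℝ x y z :=
  Function.Injective.sbtw_map_iff (f := (LinearMap.inl ℝ ℝ ℝ).toAffineMap)
    (fun _ _ h => congrArg Prod.fst h)

theorem not_sbtw_of_snd_ne_zero {x y : ℝ} {a : ℝ × ℝ} (ha : a.2 ≠ 0) :
    ¬ Sbtw ℝ ((x, 0) : ℝ × ℝ) (y, 0) a := by
  rintro ⟨⟨t, -, ht⟩, hne, -⟩
  have h2 : t = 0 := by simpa [AffineMap.lineMap_apply, ha] using congrArg Prod.snd ht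
  rw [h2, AffineMap.lineMap_apply_zero] at ht
  exact hne ht.symm

/-- The points of the carrying line, in their order on the line. -/
def linePoint (h : ℝ) (p : Fin 3 → ℝ) : Fin 5 → ℝ := ![-h, p 0, p 1, p 2, h]

theorem linePoint_node (h : ℝ) (p : Fin 3 → ℝ) (i : Fin 3) : linePoint h p (node i) = p i := by
  fin_cases i <;> rfl

/-- The labelling of the points of the circle and of its interior points, in coordinates. -/
noncomputable def labelPoint (h k r : ℝ) (p : Fin 3 → ℝ) : Label → ℝ × ℝ
  | .inl i => (linePoint h p i, 0)
  | .inr z => circlePoint h k r ((if z.1 then 1 else -1) * Real.exp z.2)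

theorem signed_exp_ne_zero (z : Bool × ℝ) :
    (if z.1 then (1 : ℝ) else -1) * Real.exp z.2 ≠ 0 := by
  have := Real.exp_pos z.2
  split_ifs <;> simp

theorem signed_exp_injective {z w : Bool × ℝ}
    (h : (if z.1 then (1 : ℝ) else -1) * Real.exp z.2 =
      (if w.1 then (1 : ℝ) else -1) * Real.exp w.2) : z = w := by
  obtain ⟨b, x⟩ := z
  obtain ⟨c, y⟩ := w
  have hx := Real.exp_pos x
  have hy := Real.exp_pos y
  cases b <;> cases c <;> simp at h ⊢
  · exact h
  · linarith
  · linarith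
  · exact h

theorem exists_signed_exp {m : ℝ} (hm : m ≠ 0) :
    ∃ z : Bool × ℝ, (if z.1 then (1 : ℝ) else -1) * Real.exp z.2 = m := by
  rcases lt_or_gt_of_ne hm with h | h
  · exact ⟨(false, Real.log (-m)), by simp only [Real.exp_log (neg_pos.2 h)]; simp⟩
  · exact ⟨(true, Real.log m), by simp [Real.exp_log h]⟩

theorem IsAdapted.linePoint_strictMono {s : Code 3} {T : (ℝ × ℝ) ≃ᵃ[ℝ] Plane} {h k : ℝ}
    {p : Fin 3 → ℝ} (H : IsAdapted s T h k p) : StrictMono (linePoint h p) := by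
  rw [Fin.strictMono_iff_lt_succ]
  intro i
  fin_cases i
  · exact H.left_lt 0
  · exact H.mono (show (0 : Fin 3) < 1 by decide)
  · exact H.mono (show (1 : Fin 3) < 2 by decide)
  · exact H.lt_right 2

theorem IsAdapted.mem_circle_iff {s : Code 3} {T : (ℝ × ℝ) ≃ᵃ[ℝ] Plane} {h k : ℝ}
    {p : Fin 3 → ℝ} (H : IsAdapted s T h k p) (a : ℝ × ℝ) :
    T a ∈ s.circle ↔ a.1 ^ 2 + a.2 ^ 2 - 2 * k * a.2 = h ^ 2 := by
  rw [EuclideanGeometry.mem_sphere, H.center, ← sq_eq_sq₀ dist_nonneg s.radius_pos.le, H.dist_sq,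
    H.radius_sq]
  constructor <;> intro h <;> simp only at * <;> linarith

theorem IsAdapted.range_labelPoint {s : Code 3} {T : (ℝ × ℝ) ≃ᵃ[ℝ] Plane} {h k : ℝ}
    {p : Fin 3 → ℝ} (H : IsAdapted s T h k p) :
    Set.range (T ∘ labelPoint h k s.circle.radius p) = s.toSet := by
  apply Set.Subset.antisymm
  · rintro _ ⟨i | z, rfl⟩
    · rcases node_cases i with rfl | rfl | ⟨j, rfl⟩
      · left
        exact (H.mem_circle_iff _).2 (by simp [labelPoint, linePoint])
      · left
        exact (H.mem_circle_iff _).2 (by simp [labelPoint, linePoint])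
      · right
        exact ⟨j, by simp [labelPoint, linePoint_node, H.pt]⟩
    · left
      exact (H.mem_circle_iff _).2 (circlePoint_mem H.pos s.radius_pos H.radius_sq _)
  · rintro X (hX | ⟨j, rfl⟩)
    · obtain ⟨⟨x, y⟩, rfl⟩ := T.surjective X
      have hxy := (H.mem_circle_iff _).1 hX
      simp only at hxy
      by_cases hy : y = 0
      · subst hy
        have : (x - h) * (x + h) = 0 := by linear_combination hxy
        rcases mul_eq_zero.1 this with h0 | h0
        · exact ⟨.inl 4, by simp [labelPoint, linePoint, sub_eq_zero.1 h0]⟩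
        · exact ⟨.inl 0, by simp [labelPoint, linePoint, eq_neg_of_add_eq_zero_left h0]⟩
      · obtain ⟨m, hm, he⟩ := exists_circlePoint_eq H.pos s.radius_pos H.radius_sq hy hxy
        obtain ⟨z, rfl⟩ := exists_signed_exp hm
        exact ⟨.inr z, congrArg T he⟩
    · exact ⟨.inl (node j), by simp [labelPoint, linePoint_node, H.pt]⟩

theorem IsAdapted.labelPoint_injective {s : Code 3} {T : (ℝ × ℝ) ≃ᵃ[ℝ] Plane} {h k : ℝ}
    {p : Fin 3 → ℝ} (H : IsAdapted s T h k p) :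
    Function.Injective (labelPoint h k s.circle.radius p) := by
  have hy := fun z => circlePoint_snd_ne_zero H.pos s.radius_pos H.radius_sq
    (signed_exp_ne_zero z)
  have hm := fun z => circlePoint_param H.pos s.radius_pos H.radius_sq (signed_exp_ne_zero z)
  rintro (i | z) (j | w) he <;> simp only [labelPoint] at he
  · rw [H.linePoint_strictMono.injective (congrArg Prod.fst he)]
  · exact absurd (congrArg Prod.snd he).symm (hy w)
  · exact absurd (congrArg Prod.snd he) (hy z)
  · refine congrArg _ (signed_exp_injective ?_)
    rw [hm z, he, ← hm w]

/-- In adapted coordinates, the reversion through `(p i, 0)` has the parameter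
`log ((h + p i) / (h - p i))`, the logarithm of the ratio of the distances from the end points of
the chord. -/
theorem IsAdapted.exists_isParam {s : Code 3} {T : (ℝ × ℝ) ≃ᵃ[ℝ] Plane} {h k : ℝ}
    {p : Fin 3 → ℝ} (H : IsAdapted s T h k p) :
    ∃ Ψ, IsParam s (fun i => Real.log ((h + p i) / (h - p i))) Ψ := by
  have hpos : ∀ i, 0 < (h + p i) / (h - p i) := fun i =>
    div_pos (by linarith [H.left_lt i]) (by linarith [H.lt_right i])
  have hmem : ∀ z, T (labelPoint h k s.circle.radius p (.inr z)) ∈ s.circle := fun z =>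
    (H.mem_circle_iff _).2 (circlePoint_mem H.pos s.radius_pos H.radius_sq _)
  have hnode : ∀ i, T (labelPoint h k s.circle.radius p (.inl (node i))) = s.pt i := fun i => by
    simp [labelPoint, linePoint_node, H.pt]
  have hy := fun z => circlePoint_snd_ne_zero H.pos s.radius_pos H.radius_sq
    (signed_exp_ne_zero z)
  -- A point of the circle is not strictly between two points of the closed disc.
  have hcirc : ∀ a c b, T (labelPoint h k s.circle.radius p c) ∈ s.circle →
      ¬ Sbtw ℝ (T (labelPoint h k s.circle.radius p a)) (T (labelPoint h k s.circle.radius p c))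
        (T (labelPoint h k s.circle.radius p b)) := by
    have hle : ∀ a, dist (T (labelPoint h k s.circle.radius p a)) s.circle.center ≤
        s.circle.radius := by
      intro a
      have : T (labelPoint h k s.circle.radius p a) ∈ s.toSet := by
        rw [← H.range_labelPoint]; exact ⟨a, rfl⟩
      rcases this with ha | ⟨j, ha⟩
      · exact (EuclideanGeometry.mem_sphere.1 ha).le
      · rw [← ha]
        exact (s.interior j).le
    intro a c b hc hs
    have hlt := hs.dist_lt_max_dist s.circle.center
    rw [EuclideanGeometry.mem_sphere.1 hc] at hlt
    exact absurd hlt (not_lt.2 (max_le (hle a) (hle b)))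
  have hrefl : ∀ i z, Sbtw ℝ (labelPoint h k s.circle.radius p (.inr z)) (p i, 0)
      (labelPoint h k s.circle.radius p
        (.inr (reflect (Real.log ((h + p i) / (h - p i))) z))) := by
    rintro i ⟨b, x⟩
    refine sbtw_circlePoint H.pos s.radius_pos H.radius_sq (H.left_lt i) (H.lt_right i)
      (signed_exp_ne_zero _) ?_
    have hne : h - p i ≠ 0 := (sub_pos.2 (H.lt_right i)).ne'
    have he := (Real.exp_pos x).ne'
    simp only [reflect, Real.exp_sub, Real.exp_log (hpos i)]
    cases b <;> simp <;> field_simp <;> ring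
  refine ⟨T ∘ labelPoint h k s.circle.radius p, fun i j hij => ?_,
    T.injective.comp H.labelPoint_injective, H.range_labelPoint, hnode, hmem, fun a c b => ?_⟩
  · apply Real.log_lt_log (hpos i)
    have := H.mono hij
    rw [div_lt_div_iff₀ (by linarith [H.lt_right i]) (by linarith [H.lt_right j])]
    nlinarith [H.pos]
  simp only [Function.comp]
  rcases c with l | z
  swap
  · exact iff_of_false (hcirc _ _ _ (hmem z)) (fun hb => by
      obtain ⟨j, hj⟩ := hb.exists_node
      cases hj)
  rcases a with i | z <;> rcases b with j | w
  · rw [T.sbtw_map_iff]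
    simp only [labelPoint, sbtw_axis_iff, sbtw_real_iff, Between,
      H.linePoint_strictMono.lt_iff_lt]
  · rw [T.sbtw_map_iff]
    exact iff_of_false (not_sbtw_of_snd_ne_zero (hy w)) id
  · rw [T.sbtw_map_iff, sbtw_comm]
    exact iff_of_false (not_sbtw_of_snd_ne_zero (hy z)) id
  rcases node_cases l with rfl | rfl | ⟨i, rfl⟩
  · refine iff_of_false (hcirc _ _ _ ((H.mem_circle_iff _).2 (by simp [labelPoint, linePoint])))
      (fun hb => ?_)
    obtain ⟨j, hj⟩ := hb.exists_node
    exact absurd (Sum.inl_injective hj) (by revert j; decide)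
  · refine iff_of_false (hcirc _ _ _ ((H.mem_circle_iff _).2 (by simp [labelPoint, linePoint])))
      (fun hb => ?_)
    obtain ⟨j, hj⟩ := hb.exists_node
    exact absurd (Sum.inl_injective hj) (by revert j; decide)
  · have hrefl' : ∀ z, Sbtw ℝ (T (labelPoint h k s.circle.radius p (.inr z))) (s.pt i)
        (T (labelPoint h k s.circle.radius p
          (.inr (reflect (Real.log ((h + p i) / (h - p i))) z)))) := by
      intro z
      rw [H.pt, T.sbtw_map_iff]
      exact hrefl i z
    rw [between_inr_inr, hnode]
    constructor
    · intro hs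
      have h1 := (eq_reversion_iff (s.interior i) (hmem z)).2 ⟨hmem w, hs⟩
      have h2 := (eq_reversion_iff (s.interior i) (hmem z)).2 ⟨hmem _, hrefl' z⟩
      exact Sum.inr_injective (H.labelPoint_injective (T.injective (h1.trans h2.symm)))
    · rintro rfl
      exact hrefl' z

theorem Code.exists_isParam (s : Code 3) : ∃ ℓ Ψ, IsParam s ℓ Ψ := by
  obtain ⟨T, h, k, p, H⟩ := s.exists_isAdapted
  exact ⟨_, H.exists_isParam⟩

/-- All increasing triples of parameters occur, on a diameter of the unit circle. -/
theorem exists_code_isParam {ℓ : Fin 3 → ℝ} (hℓ : StrictMono ℓ) :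
    ∃ (s : Code 3) (Ψ : Label → Plane), IsParam s ℓ Ψ := by
  have hu : (!₂[(1 : ℝ), 0] : Plane) 0 ^ 2 + (!₂[(1 : ℝ), 0] : Plane) 1 ^ 2 = 1 := by simp
  let T := frame 0 !₂[1, 0] hu
  -- Solve `exp (ℓ i) = (1 + p i) / (1 - p i)`.
  let p : Fin 3 → ℝ := fun i => 1 - 2 / (Real.exp (ℓ i) + 1)
  have hexp : ∀ i, 0 < Real.exp (ℓ i) := fun i => Real.exp_pos _
  have hlt : ∀ i, p i < 1 := fun i => by
    have : 0 < 2 / (Real.exp (ℓ i) + 1) := by have := hexp i; positivity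
    simp only [p]
    linarith
  have hgt : ∀ i, -1 < p i := fun i => by
    have : 2 / (Real.exp (ℓ i) + 1) < 2 := by
      rw [div_lt_iff₀ (by linarith [hexp i])]
      linarith [hexp i]
    simp only [p]
    linarith
  have hmono : StrictMono p := fun i j hij => by
    have h1 : Real.exp (ℓ i) < Real.exp (ℓ j) := Real.exp_lt_exp.2 (hℓ hij)
    have h2 : 2 / (Real.exp (ℓ j) + 1) < 2 / (Real.exp (ℓ i) + 1) :=
      div_lt_div_of_pos_left two_pos (by linarith [hexp i]) (by linarith)
    simp only [p]
    linarith
  let s : Code 3 :=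
    { circle := ⟨T (0, 0), 1⟩
      radius_pos := one_pos
      pt := fun i => T (p i, 0)
      interior := fun i => by
        rw [← sq_lt_sq₀ dist_nonneg zero_le_one, dist_frame_sq]
        simp only
        nlinarith [hlt i, hgt i]
      ordered := by
        refine ⟨0, !₂[1, 0], p, fun h => ?_, Or.inl hmono, fun i => ?_⟩
        · have := congrArg (fun X : Plane => X 0) h
          simp at this
        · ext j
          fin_cases j
          · simp [T, frame_zero]
          · simp [T, frame_one] }
  have H : IsAdapted s T 1 0 p :=
    { dist_sq := dist_frame_sq _ _ _
      pos := one_pos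
      center := rfl
      radius_sq := by simp [s]
      pt := fun i => rfl
      mono := hmono
      left_lt := hgt
      lt_right := hlt }
  obtain ⟨Ψ, hΨ⟩ := H.exists_isParam
  refine ⟨s, Ψ, ?_⟩
  convert hΨ using 1
  funext i
  have h0 := hexp i
  rw [show (1 + p i) / (1 - p i) = Real.exp (ℓ i) by simp only [p]; field_simp; ring,
    Real.log_exp]

/-! ### The classification -/

theorem BetweennessIsomorphic.refl (S : Set Plane) : BetweennessIsomorphic S S :=
  ⟨Equiv.refl _, fun _ _ _ => Iff.rfl⟩

theorem BetweennessIsomorphic.symm {S R : Set Plane} (h : BetweennessIsomorphic S R) :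
    BetweennessIsomorphic R S := by
  obtain ⟨f, hf⟩ := h
  exact ⟨f.symm, fun a b c => by simpa using (hf (f.symm a) (f.symm b) (f.symm c)).symm⟩

theorem Code.toSet_mem (s : Code 3) : s.toSet ∈ circlesWithThreeCollinearPoints := by
  obtain ⟨q, d, t, hd, ht, hpt⟩ := s.ordered
  have htinj : Function.Injective t := ht.elim StrictMono.injective StrictAnti.injective
  refine ⟨s.circle, s.pt, s.radius_pos, s.interior, fun i j hij => htinj ?_, ?_, rfl⟩
  · rw [hpt, hpt, add_right_inj] at hij
    exact smul_left_injective ℝ hd hij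
  · rw [collinear_iff_exists_forall_eq_smul_vadd]
    refine ⟨q, d, ?_⟩
    rintro _ ⟨i, rfl⟩
    exact ⟨t i, by rw [hpt, vadd_eq_add, add_comm]⟩

theorem exists_code_of_mem {S : Set Plane} (hS : S ∈ circlesWithThreeCollinearPoints) :
    ∃ s : Code 3, s.toSet = S := by
  obtain ⟨C, p, hr, hint, hinj, hcol, rfl⟩ := hS
  obtain ⟨q, d, hqd⟩ := (collinear_iff_exists_forall_eq_smul_vadd (k := ℝ) _).1 hcol
  choose t ht using fun i => hqd (p i) ⟨i, rfl⟩
  have htinj : Function.Injective t := fun i j hij => hinj (by rw [ht, ht, hij])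
  refine ⟨⟨C, hr, p ∘ Tuple.sort t, fun i => hint _, q, d, t ∘ Tuple.sort t, ?_, Or.inl ?_,
    fun i => ?_⟩, ?_⟩
  · rintro rfl
    exact absurd (hinj (show p 0 = p 1 by rw [ht, ht 1, smul_zero, smul_zero])) (by decide)
  · exact (Tuple.monotone_sort t).strictMono_of_injective
      (htinj.comp (Tuple.sort t).injective)
  · simp only [Function.comp]
    rw [ht (Tuple.sort t i), vadd_eq_add, add_comm]
  · simp only [Code.toSet, (Tuple.sort t).surjective.range_comp]

theorem isCycle_rev {s : Code 3} {v : Fin 3 → ℤ} : IsCycle s.rev v ↔ IsCycle s (v ∘ Fin.rev) := by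
  obtain ⟨ℓ, Ψ, h⟩ := s.exists_isParam
  obtain ⟨Ψ', h'⟩ := h.rev
  rw [h.isCycle_iff, h'.isCycle_iff, isRelation_neg_rev]

theorem isCycle_zero (s : Code 3) : IsCycle s 0 := by
  obtain ⟨ℓ, Ψ, h⟩ := s.exists_isParam
  rw [h.isCycle_iff]
  simp [IsRelation]

theorem IsCycle.of_betweennessIsomorphic {s s' : Code 3} {v : Fin 3 → ℤ} (hv : IsCycle s v)
    (h : BetweennessIsomorphic s.toSet s'.toSet) : IsCycle s' v ∨ IsCycle s' (v ∘ Fin.rev) := by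
  obtain ⟨ℓ, Ψ, hs⟩ := s.exists_isParam
  obtain ⟨ℓ', Ψ', hs'⟩ := s'.exists_isParam
  obtain ⟨f, hf⟩ := (hs.betweennessIsomorphic_iff hs').1 h
  rw [hs'.isCycle_iff, hs'.isCycle_iff]
  exact (hs.isCycle_iff.1 hv).of_equiv f hf

theorem isoClass_eq_cycleClass {v : Fin 3 → ℤ} (hv : v ∈ normalizedVectors) {S : Set Plane}
    (hS : S ∈ cycleClass v) :
    {R | R ∈ circlesWithThreeCollinearPoints ∧ BetweennessIsomorphic S R} = cycleClass v := by
  obtain ⟨s, hs, rfl⟩ := hS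
  ext R
  constructor
  · rintro ⟨hR, h⟩
    obtain ⟨s', rfl⟩ := exists_code_of_mem hR
    rcases hs.of_betweennessIsomorphic h with h' | h'
    · exact ⟨s', h', rfl⟩
    · exact ⟨s'.rev, isCycle_rev.2 h', s'.rev_toSet⟩
  · rintro ⟨s', hs', rfl⟩
    refine ⟨s'.toSet_mem, ?_⟩
    obtain ⟨ℓ, Ψ, h⟩ := s.exists_isParam
    obtain ⟨ℓ', Ψ', h'⟩ := s'.exists_isParam
    rw [h.betweennessIsomorphic_iff h']
    have hv2 : v 2 ≠ 0 := by have := hv.2.2.2.1; omega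
    exact exists_model_equiv_of_common_relation h.mono h'.mono hv2 (h.isCycle_iff.1 hs)
      (h'.isCycle_iff.1 hs')

theorem isoClass_eq_zeroClass {S : Set Plane} (hS : S ∈ zeroClass) :
    {R | R ∈ circlesWithThreeCollinearPoints ∧ BetweennessIsomorphic S R} = zeroClass := by
  obtain ⟨s, hs, rfl⟩ := hS
  ext R
  constructor
  · rintro ⟨hR, h⟩
    obtain ⟨s', rfl⟩ := exists_code_of_mem hR
    refine ⟨s', fun v => ⟨fun hv => ?_, ?_⟩, rfl⟩
    · rcases hv.of_betweennessIsomorphic h.symm with h' | h'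
      · exact (hs v).1 h'
      · have h0 := (hs _).1 h'
        funext i
        simpa using congrFun h0 i.rev
    · rintro rfl
      exact isCycle_zero s'
  · rintro ⟨s', hs', rfl⟩
    refine ⟨s'.toSet_mem, ?_⟩
    obtain ⟨ℓ, Ψ, h⟩ := s.exists_isParam
    obtain ⟨ℓ', Ψ', h'⟩ := s'.exists_isParam
    rw [h.betweennessIsomorphic_iff h']
    exact exists_model_equiv_of_no_relations (fun v hv => (hs v).1 (h.isCycle_iff.2 hv))
      (fun v hv => (hs' v).1 (h'.isCycle_iff.2 hv))

theorem gcd_eq_one_iff {v : Fin 3 → ℤ} (hv : ∑ i, v i = 0) :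
    Finset.univ.gcd v = 1 ↔ IsCoprime (v 0) (v 2) := by
  rw [Fin.sum_univ_three] at hv
  have h1 : v 1 = -v 0 - v 2 := by linarith
  rw [Int.isCoprime_iff_gcd_eq_one]
  constructor
  · intro h
    have hd : ((Int.gcd (v 0) (v 2) : ℕ) : ℤ) ∣ Finset.univ.gcd v := by
      refine Finset.dvd_gcd fun i _ => ?_
      have h0 : ((Int.gcd (v 0) (v 2) : ℕ) : ℤ) ∣ v 0 := Int.gcd_dvd_left ..
      have h2 : ((Int.gcd (v 0) (v 2) : ℕ) : ℤ) ∣ v 2 := Int.gcd_dvd_right ..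
      fin_cases i
      · exact h0
      · exact h1 ▸ dvd_sub (dvd_neg.2 h0) h2
      · exact h2
    rw [h] at hd
    exact_mod_cast Int.eq_one_of_dvd_one (by positivity) hd
  · intro h
    rw [← Finset.normalize_gcd, normalize_eq_one]
    have hd := Int.dvd_coe_gcd (Finset.gcd_dvd (f := v) (Finset.mem_univ 0))
      (Finset.gcd_dvd (f := v) (Finset.mem_univ 2))
    rw [h] at hd
    exact isUnit_of_dvd_one hd

theorem eq_of_mem_normalizedVectors {v w : Fin 3 → ℤ} (hv : v ∈ normalizedVectors)
    (hw : w ∈ normalizedVectors) (h : v 0 * w 2 = v 2 * w 0) : v = w := by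
  obtain ⟨hv0, -, hv2, hv3, hv4⟩ := hv
  obtain ⟨hw0, -, hw2, hw3, hw4⟩ := hw
  rw [gcd_eq_one_iff hv0] at hv4
  rw [gcd_eq_one_iff hw0] at hw4
  rw [Fin.sum_univ_three] at hv0 hw0
  have d1 : v 0 ∣ w 0 := hv4.dvd_of_dvd_mul_left ⟨w 2, h.symm⟩
  have d2 : w 0 ∣ v 0 := hw4.dvd_of_dvd_mul_right ⟨v 2, by rw [h, mul_comm]⟩
  have e0 : v 0 = w 0 := by
    have := Int.dvd_antisymm (a := -v 0) (b := -w 0) (by omega) (by omega)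
      (neg_dvd.2 (dvd_neg.2 d1)) (neg_dvd.2 (dvd_neg.2 d2))
    omega
  have e2 : v 2 = w 2 := by
    rw [← e0, mul_comm (v 2)] at h
    exact (mul_left_cancel₀ (by omega) h).symm
  funext i
  fin_cases i
  · exact e0
  · change v 1 = w 1
    omega
  · exact e2

theorem strictMono_fin_three {a b c : ℝ} (hab : a < b) (hbc : b < c) :
    StrictMono ![a, b, c] := by
  rw [Fin.strictMono_iff_lt_succ]
  intro i
  fin_cases i
  · exact hab
  · exact hbc

theorem cycleClass_nonempty {v : Fin 3 → ℤ} (hv : v ∈ normalizedVectors) :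
    (cycleClass v).Nonempty := by
  obtain ⟨h0, -, h2, h3, -⟩ := hv
  have h3' : (v 2 : ℝ) ≤ -1 := by exact_mod_cast h3
  have h2' : (v 0 : ℝ) ≤ v 2 := by exact_mod_cast h2
  obtain ⟨s, Ψ, h⟩ := exists_code_isParam (ℓ := ![0, -(v 2 : ℝ), -(v 2 : ℝ) - v 0])
    (strictMono_fin_three (by linarith) (by linarith))
  refine ⟨s.toSet, s, h.isCycle_iff.2 (isRelation_iff.2 ⟨?_, ?_⟩), rfl⟩
  · rw [Fin.sum_univ_three] at h0
    linarith
  · simp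
    ring

theorem cycleClass_injOn :
    Set.InjOn (fun v : Fin 3 → ℤ => cycleClass v) normalizedVectors := by
  intro v hv w hw (hvw : cycleClass v = cycleClass w)
  obtain ⟨S, hS⟩ := cycleClass_nonempty hv
  have hS' : S ∈ cycleClass w := hvw ▸ hS
  obtain ⟨s, hs, rfl⟩ := hS
  obtain ⟨s', hs', he⟩ := hS'
  obtain ⟨ℓ, Ψ, h⟩ := s.exists_isParam
  have a0 : ℓ 1 - ℓ 0 ≠ 0 := (sub_pos.2 (h.mono (by decide))).ne'
  -- Relations between the same parameters are proportional.
  have key : ∀ u : Fin 3 → ℤ, IsCycle s u → v 0 * u 2 = v 2 * u 0 := by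
    intro u hu
    have h1 := (isRelation_iff.1 (h.isCycle_iff.1 hs)).2
    have h2 := (isRelation_iff.1 (h.isCycle_iff.1 hu)).2
    have : (v 0 : ℝ) * u 2 = v 2 * u 0 := by
      apply mul_left_cancel₀ a0
      linear_combination (u 2 : ℝ) * h1 - (v 2 : ℝ) * h2
    exact_mod_cast this
  apply eq_of_mem_normalizedVectors hv hw
  rcases hs'.of_betweennessIsomorphic (s' := s) (he ▸ .refl _) with h' | h'
  · exact key w h'
  · -- Here `v 0 * w 0 = v 2 * w 2`, although `v 0 ≤ v 2 < 0` and `w 0 ≤ w 2 < 0`.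
    have h1 : v 0 * w 0 = v 2 * w 2 := key _ h'
    obtain ⟨-, -, hv2, hv3, -⟩ := hv
    obtain ⟨-, -, hw2, hw3, -⟩ := hw
    have e1 : v 0 = v 2 := by nlinarith
    have e2 : w 0 = w 2 := by nlinarith
    rw [e1, e2]

theorem zeroClass_nonempty : zeroClass.Nonempty := by
  have h2 : 0 < √(2 : ℝ) := by positivity
  obtain ⟨s, Ψ, h⟩ := exists_code_isParam (ℓ := ![0, 1, 1 + √2])
    (strictMono_fin_three (by linarith) (by linarith))
  refine ⟨s.toSet, s, fun v => ⟨fun hv => ?_, ?_⟩, rfl⟩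
  · obtain ⟨h1, h3⟩ := isRelation_iff.1 (h.isCycle_iff.1 hv)
    simp at h3
    have hv2 : v 2 = 0 := by
      by_contra hne
      exact (irrational_sqrt_two.intCast_mul hne) ⟨(v 0 : ℚ), by push_cast; exact h3⟩
    have hv0 : v 0 = 0 := by
      rw [hv2] at h3
      simpa using h3
    funext i
    fin_cases i
    · exact hv0
    · change v 1 = 0
      omega
    · exact hv2
  · rintro rfl
    exact isCycle_zero s

theorem zero_notMem_normalizedVectors : (0 : Fin 3 → ℤ) ∉ normalizedVectors := fun h => by
  have := h.2.1
  simp at this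

theorem cycleClass_ne_zeroClass {v : Fin 3 → ℤ} (hv : v ∈ normalizedVectors) :
    cycleClass v ≠ zeroClass := by
  intro he
  obtain ⟨S, s, hs, rfl⟩ := cycleClass_nonempty hv
  have hS : s.toSet ∈ zeroClass := he ▸ ⟨s, hs, rfl⟩
  obtain ⟨s', hs', hss⟩ := hS
  have h0 : v = 0 := by
    rcases hs.of_betweennessIsomorphic (s' := s') (hss ▸ .refl _) with h' | h'
    · exact (hs' v).1 h'
    · have h0 := (hs' _).1 h'
      funext i
      simpa using congrFun h0 i.rev
  exact zero_notMem_normalizedVectors (h0 ▸ hv)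

theorem mem_normalizedVectors_of_coprime {a b : ℕ} (hb : 0 < b) (hba : b ≤ a)
    (hab : Nat.Coprime a b) : ![-(a : ℤ), a + b, -(b : ℤ)] ∈ normalizedVectors := by
  have hsum : ∑ i, ![-(a : ℤ), a + b, -(b : ℤ)] i = 0 := by
    rw [Fin.sum_univ_three]
    simp
  refine ⟨hsum, ?_, ?_, ?_, (gcd_eq_one_iff hsum).2 ?_⟩
  · change (1 : ℤ) ≤ a + b
    omega
  · change -(a : ℤ) ≤ -b
    omega
  · change -(b : ℤ) ≤ -1
    omega
  · exact (Nat.isCoprime_iff_coprime.2 hab).neg_neg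

/-- A nonzero cycle makes the ratio of the two gaps between the parameters rational, and its
reduced fraction provides a normalized cycle, possibly for the reversed code. -/
theorem Code.mem_cycleClass_or_mem_zeroClass (s : Code 3) :
    (∃ v ∈ normalizedVectors, s.toSet ∈ cycleClass v) ∨ s.toSet ∈ zeroClass := by
  by_cases hz : ∀ v, IsCycle s v → v = 0
  · exact Or.inr ⟨s, fun v => ⟨hz v, by rintro rfl; exact isCycle_zero s⟩, rfl⟩
  left
  push Not at hz
  obtain ⟨v, hv, hv0⟩ := hz
  obtain ⟨ℓ, Ψ, h⟩ := s.exists_isParam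
  obtain ⟨h1, h2⟩ := isRelation_iff.1 (h.isCycle_iff.1 hv)
  have hα : 0 < ℓ 1 - ℓ 0 := sub_pos.2 (h.mono (by decide))
  have hβ : 0 < ℓ 2 - ℓ 1 := sub_pos.2 (h.mono (by decide))
  have hne : (v 0 : ℝ) ≠ 0 := by
    intro h0
    rw [h0, zero_mul, eq_comm, mul_eq_zero, or_iff_left hβ.ne'] at h2
    have h0' : v 0 = 0 := by exact_mod_cast h0
    have h2' : v 2 = 0 := by exact_mod_cast h2
    apply hv0
    funext i
    fin_cases i
    · exact h0'
    · change v 1 = 0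
      omega
    · exact h2'
  obtain ⟨q, hq⟩ : ∃ q : ℚ, (q : ℝ) = (ℓ 1 - ℓ 0) / (ℓ 2 - ℓ 1) :=
    ⟨(v 2 : ℚ) / v 0, by push_cast; field_simp; linarith⟩
  have hqpos : 0 < q := by
    have : (0 : ℝ) < q := hq ▸ div_pos hα hβ
    exact_mod_cast this
  obtain ⟨b, hb⟩ : ∃ b : ℕ, q.num = b := Int.eq_ofNat_of_zero_le (Rat.num_pos.2 hqpos).le
  have hb0 : 0 < b := by have := Rat.num_pos.2 hqpos; omega
  have hcop : Nat.Coprime b q.den := by have := q.reduced; rwa [hb, Int.natAbs_natCast] at this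
  have hq' : (q.den : ℝ) * (ℓ 1 - ℓ 0) = b * (ℓ 2 - ℓ 1) := by
    have h3 : (q : ℝ) = b / q.den := by
      conv_lhs => rw [← Rat.num_div_den q, hb]
      push_cast
      rfl
    have hd : (q.den : ℝ) ≠ 0 := by exact_mod_cast q.den_nz
    rw [h3] at hq
    field_simp at hq
    linarith
  have hcyc : IsCycle s ![-(q.den : ℤ), q.den + b, -(b : ℤ)] := by
    rw [h.isCycle_iff, isRelation_iff]
    refine ⟨by simp, ?_⟩
    simp only [Matrix.cons_val]
    push_cast
    linarith
  rcases le_total b q.den with hle | hle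
  · exact ⟨_, mem_normalizedVectors_of_coprime hb0 hle hcop.symm, s, hcyc, rfl⟩
  · refine ⟨_, mem_normalizedVectors_of_coprime q.den_pos hle hcop, s.rev, isCycle_rev.2 ?_,
      s.rev_toSet⟩
    convert hcyc using 1
    funext i
    fin_cases i
    · rfl
    · exact add_comm _ _
    · rfl

theorem normalizedVectors_infinite : normalizedVectors.Infinite := by
  refine Set.infinite_of_injective_forall_mem
    (f := fun n : ℕ => ![-((n + 1 : ℕ) : ℤ), ((n + 1 : ℕ) : ℤ) + (1 : ℕ), -((1 : ℕ) : ℤ)])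
    (fun m n hmn => ?_)
    (fun n => mem_normalizedVectors_of_coprime one_pos (by omega) (Nat.coprime_one_right _))
  have : -((m + 1 : ℕ) : ℤ) = -((n + 1 : ℕ) : ℤ) := congrFun hmn 0
  omega

theorem isoClasses_eq : isoClasses circlesWithThreeCollinearPoints =
    (fun v : Fin 3 → ℤ => cycleClass v) '' normalizedVectors ∪ {zeroClass} := by
  ext K
  constructor
  · rintro ⟨S, hS, rfl⟩
    obtain ⟨s, rfl⟩ := exists_code_of_mem hS
    rcases s.mem_cycleClass_or_mem_zeroClass with ⟨v, hv, h⟩ | h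
    · exact Or.inl ⟨v, hv, (isoClass_eq_cycleClass hv h).symm⟩
    · exact Or.inr (isoClass_eq_zeroClass h)
  · rintro (⟨v, hv, rfl⟩ | rfl)
    · obtain ⟨S, hS⟩ := cycleClass_nonempty hv
      have hS' := hS
      obtain ⟨s, -, rfl⟩ := hS'
      exact ⟨s.toSet, s.toSet_mem, (isoClass_eq_cycleClass hv hS).symm⟩
    · obtain ⟨S, hS⟩ := zeroClass_nonempty
      have hS' := hS
      obtain ⟨s, -, rfl⟩ := hS'
      exact ⟨s.toSet, s.toSet_mem, (isoClass_eq_zeroClass hS).symm⟩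

end CircleBetweenness

open CircleBetweenness
theorem theorem4p5 :
    isoClasses circlesWithThreeCollinearPoints =
        (fun v : Fin 3 → ℤ => cycleClass v) '' normalizedVectors ∪ {zeroClass} ∧
      Set.InjOn (fun v : Fin 3 → ℤ => cycleClass v) normalizedVectors ∧
      (∀ v ∈ normalizedVectors, cycleClass v ≠ zeroClass) ∧
      (isoClasses circlesWithThreeCollinearPoints).Countable ∧
      (isoClasses circlesWithThreeCollinearPoints).Infinite := by
  refine ⟨isoClasses_eq, cycleClass_injOn, fun v hv => cycleClass_ne_zeroClass hv, ?_, ?_⟩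
  · rw [isoClasses_eq]
    exact ((Set.to_countable _).image _).union (Set.countable_singleton _)
  · rw [isoClasses_eq]
    exact (normalizedVectors_infinite.image cycleClass_injOn).mono Set.subset_union_left
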